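/- Conventions. An MTL-algebra is a bounded commutative integral residuated lattice $\mathbf A=(A,\cdot,\to,\wedge,\vee,0,1)$ satisfying $(x\to y)\vee(y\to x)=1$; put $\neg x=x\to 0$, $x\oplus y=\neg x\to y$, $2x=x\oplus x$, $x^2=x\cdot x$. An IBP$_0$-algebra is an MTL-algebra satisfying $(2x)^2=2(x^2)$ and $\neg\neg x=x$. For such $\mathbf A$ let $\mathscr B(\mathbf A)=\{a\in A: a\vee\neg a=1\}$, a Boolean algebra under the operations of $\mathbf A$, and let $\mathscr H(\mathbf A)=\{x\in A: x>\neg x\}$, which (if $0\neq 1$ in $A$) is a prelinear semihoop $(\mathscr H(\mathbf A),\cdot,\to,\wedge,1)$ under the operations of $\mathbf A$. For $a\in A$ put $b_a=\neg\big((\neg(a^2))^2\big)\in\mathscr B(\mathbf A)$ and $c_a=a\vee\neg a\in\mathscr H(\mathbf A)$; for $b\in\mathscr B(\mathbf A)$ and $c\in\mathscr H(\mathbf A)$ one has $b\vee c\in\mathscr H(\mathbf A)$. A state of a prelinear semihoop $\mathbf H$ is a map $w$ from $H$ to the nonpositive reals with $w(1)=0$, $w(x\cdot y)=w(x)+w(y)$,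 and $w(x)\le w(y)$ whenever $x\le y$. Let $\mathbb R\times\mathbb R$ be the lexicographically ordered group, in which the real $r$ is identified with $(r,0)$, and let $\mathscr L(\mathbb R)=\{x\in\mathbb R\times\mathbb R : 0\le x\le 1\}$ with $1=(1,0)$. An element $\varepsilon$ of $\mathbb R\times\mathbb R$ is infinitesimal if $n|\varepsilon|<1$ for all $n\in\mathbb N$. A hyperstate of $\mathbf A$ is a map $s:A\to\mathscr L(\mathbb R)$ such that $s(1)=1$ and $s(0)=0$; $s(x\oplus y)+s(x\cdot y)=s(x)+s(y)$ for all $x,y\in A$ (sums in $\mathbb R\times\mathbb R$); and $s(x)$ is a real number in $[0,1]$ whenever $x\vee\neg x=1$. Statement. For every IBP$_0$-algebra $\mathbf A$ and every hyperstate $s:A\to\mathscr L(\mathbb R)$ (so that $0\ne1$ in $A$), there are a regular Borel probability measure $\mu_s$ on the Stone space $Max(\mathscr B(\mathbf A))$ of maximal filters of $\mathscr B(\mathbf A)$, a state $w$ of the prelinear semihoop $\mathscr H(\mathbf A)$, and an infinitesimal $\varepsilon>0$ such that, for every $a\in A$, $$s(a)=\int_{Max(\mathscr B(\mathbf A))}(b_a)^*\,d\mu_s+\varepsilon\,\big(w(\neg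 b_a\vee c_a)-w(b_a\vee c_a)\big),$$ where $(b_a)^*$ is the characteristic function of the clopen set $\{F\in Max(\mathscr B(\mathbf A)): b_a\in F\}$. -/

import Mathlib

open MeasureTheory

/-! ### Prelinear semihoops and their states -/

/-- A semihoop `(H, ·, →, ∧, 1)`; the residual `→` is written `⇨`, the meet `⊓`. -/
class Semihoop (H : Type*) extends SemilatticeInf H, CommMonoid H, HImp H where
  le_one' : ∀ x : H, x ≤ 1
  mul_mono' : ∀ x y z : H, x ≤ y → x * z ≤ y * z
  le_iff_himp' : ∀ x y : H, x ≤ y ↔ x ⇨ y = 1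
  mul_himp' : ∀ x y z : H, (x * y) ⇨ z = x ⇨ (y ⇨ z)

/-- A prelinear semihoop. -/
class PrelinearSemihoop (H : Type*) extends Semihoop H where
  prelinear' : ∀ x y z : H, (x ⇨ y) ⇨ z ≤ ((y ⇨ x) ⇨ z) ⇨ z

/-- A state of a prelinear semihoop: a map to the nonpositive reals satisfying (v1)-(v3). -/
structure IsSemihoopState {H : Type*} [PrelinearSemihoop H] (w : H → ℝ) : Prop where
  nonpos : ∀ x, w x ≤ 0
  map_one : w 1 = 0
  map_mul : ∀ x y, w (x * y) = w x + w y
  mono : ∀ x y, x ≤ y → w x ≤ w y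

/-! ### MTL-algebras and IBP₀-algebras -/

/-- MTL-algebras: bounded commutative integral residuated lattices with the prelinearity
equation. The bounds are `0` and `1`, and `1` is the unit of the monoid; the residual is `⇨`. -/
class MTLAlgebra (A : Type*) extends Lattice A, CommMonoid A, Zero A, HImp A where
  zero_le' : ∀ x : A, 0 ≤ x
  le_one' : ∀ x : A, x ≤ 1
  mul_le_iff' : ∀ x y z : A, x * y ≤ z ↔ x ≤ y ⇨ z
  prelinear' : ∀ x y : A, (x ⇨ y) ⊔ (y ⇨ x) = 1

namespace MTLAlgebra

variable {A : Type*} [MTLAlgebra A]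

/-- `¬x := x → 0`. -/
def neg (x : A) : A := x ⇨ 0

/-- `x ⊕ y := ¬x → y`. -/
def oplus (x y : A) : A := neg x ⇨ y

theorem mul_mono_right {x y : A} (h : x ≤ y) (z : A) : x * z ≤ y * z :=
  (mul_le_iff' x z (y * z)).2 (h.trans ((mul_le_iff' y z (y * z)).1 le_rfl))

theorem mul_mono {x y z t : A} (h : x ≤ y) (h' : z ≤ t) : x * z ≤ y * t := by
  refine (mul_mono_right h z).trans ?_
  rw [mul_comm y z, mul_comm y t]
  exact mul_mono_right h' y

theorem mul_le_left (x y : A) : x * y ≤ x := by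
  simpa using mul_mono (le_refl x) (le_one' y)

theorem mul_le_right (x y : A) : x * y ≤ y := by
  rw [mul_comm]; exact mul_le_left y x

theorem himp_mul_le (x y : A) : (x ⇨ y) * x ≤ y := (mul_le_iff' _ _ _).2 le_rfl

theorem mul_himp_le (x y : A) : x * (x ⇨ y) ≤ y := by
  rw [mul_comm]; exact himp_mul_le x y

theorem mul_sup_distrib (x y z : A) : x * (y ⊔ z) = x * y ⊔ x * z := by
  apply le_antisymm
  · rw [mul_comm, mul_le_iff']
    refine sup_le ?_ ?_
    · rw [← mul_le_iff', mul_comm]; exact le_sup_left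
    · rw [← mul_le_iff', mul_comm]; exact le_sup_right
  · exact sup_le (mul_mono le_rfl le_sup_left) (mul_mono le_rfl le_sup_right)

theorem le_iff_himp (x y : A) : x ≤ y ↔ x ⇨ y = 1 := by
  constructor
  · intro h
    refine le_antisymm (le_one' _) ?_
    rw [← mul_le_iff', one_mul]; exact h
  · intro h
    have h1 := (mul_le_iff' 1 x y).2 h.ge
    rwa [one_mul] at h1

theorem mul_himp (x y z : A) : (x * y) ⇨ z = x ⇨ (y ⇨ z) := by
  apply le_antisymm
  · rw [← mul_le_iff', ← mul_le_iff', mul_assoc]; exact himp_mul_le _ _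
  · rw [← mul_le_iff', ← mul_assoc]
    exact (mul_mono_right (himp_mul_le _ _) y).trans (himp_mul_le _ _)

theorem prelinear_semihoop (x y z : A) : (x ⇨ y) ⇨ z ≤ ((y ⇨ x) ⇨ z) ⇨ z := by
  rw [← mul_le_iff']
  set u := (x ⇨ y) ⇨ z with hu
  set v := (y ⇨ x) ⇨ z with hv
  have h : u * v = u * v * ((x ⇨ y) ⊔ (y ⇨ x)) := by rw [prelinear', mul_one]
  rw [h, mul_sup_distrib]
  refine sup_le ?_ ?_
  · rw [mul_right_comm]
    exact (mul_le_left _ _).trans (himp_mul_le _ _)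
  · rw [mul_assoc]
    exact (mul_le_right _ _).trans (himp_mul_le _ _)

theorem inf_sup_le (x y z : A) : x ⊓ (y ⊔ z) ≤ (x ⊓ y) ⊔ (x ⊓ z) := by
  set t := x ⊓ (y ⊔ z) with ht
  have h : t = t * ((y ⇨ z) ⊔ (z ⇨ y)) := by rw [prelinear', mul_one]
  have key : ∀ p q : A, t ≤ p ⊔ q → t * (p ⇨ q) ≤ x ⊓ q := fun p q hpq => by
    refine le_inf ((mul_le_left _ _).trans inf_le_left) ((mul_mono_right hpq _).trans ?_)
    rw [mul_comm, mul_sup_distrib]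
    exact sup_le (himp_mul_le _ _) (mul_le_right _ _)
  rw [h, mul_sup_distrib]
  refine sup_le ((key y z inf_le_right).trans le_sup_right)
    ((key z y ?_).trans le_sup_left)
  rw [sup_comm]; exact inf_le_right

/-- The lattice reduct of an MTL-algebra is distributive. -/
theorem le_sup_inf' (x y z : A) : (x ⊔ y) ⊓ (x ⊔ z) ≤ x ⊔ y ⊓ z := by
  refine (inf_sup_le _ _ _).trans (sup_le (inf_le_right.trans le_sup_left) ?_)
  rw [inf_comm]
  refine (inf_sup_le _ _ _).trans (sup_le (inf_le_right.trans le_sup_left) ?_)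
  rw [inf_comm]; exact le_sup_right

theorem mul_neg_self (x : A) : x * neg x = 0 :=
  le_antisymm (mul_himp_le x 0) (zero_le' _)

theorem neg_anti {x y : A} (h : x ≤ y) : neg y ≤ neg x := by
  unfold neg
  rw [← mul_le_iff']
  exact (mul_mono le_rfl h).trans (himp_mul_le y 0)

theorem neg_inf_neg_le (x y : A) : neg x ⊓ neg y ≤ neg (x ⊔ y) := by
  show _ ≤ (x ⊔ y) ⇨ (0 : A)
  rw [← mul_le_iff', mul_sup_distrib]
  exact sup_le ((mul_mono inf_le_left le_rfl).trans (himp_mul_le x 0))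
    ((mul_mono inf_le_right le_rfl).trans (himp_mul_le y 0))

theorem sup_sq_eq_one {x y : A} (h : x ⊔ y = 1) : x ^ 2 ⊔ y ^ 2 = 1 := by
  refine le_antisymm (le_one' _) ?_
  have e : (1 : A) = (x ⊔ y) * ((x ⊔ y) * (x ⊔ y)) := by rw [h]; simp
  have hx : x * x ≤ x ^ 2 ⊔ y ^ 2 := by rw [← pow_two]; exact le_sup_left
  have hy : y * y ≤ x ^ 2 ⊔ y ^ 2 := by rw [← pow_two]; exact le_sup_right
  rw [e, mul_sup_distrib (x ⊔ y) x y, mul_sup_distrib, mul_comm (x ⊔ y) x, mul_comm (x ⊔ y) y, mul_sup_distrib, mul_sup_distrib,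
    mul_sup_distrib, mul_sup_distrib]
  refine sup_le ?_ ?_
  · rw [mul_comm (x ⊔ y), mul_comm (x ⊔ y), mul_sup_distrib, mul_sup_distrib]
    refine sup_le (sup_le ?_ ?_) (sup_le ?_ ?_)
    · exact (mul_le_left _ _).trans hx
    · exact (mul_le_left _ _).trans hx
    · rw [mul_right_comm]; exact (mul_le_left _ _).trans hx
    · rw [mul_assoc]; exact (mul_le_right _ _).trans hy
  · rw [mul_comm (x ⊔ y), mul_comm (x ⊔ y), mul_sup_distrib, mul_sup_distrib]
    refine sup_le (sup_le ?_ ?_) (sup_le ?_ ?_)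
    · rw [mul_assoc]; exact (mul_le_right _ _).trans hx
    · rw [mul_right_comm]; exact (mul_le_left _ _).trans hy
    · exact (mul_le_left _ _).trans hy
    · exact (mul_le_left _ _).trans hy

end MTLAlgebra

open MTLAlgebra in
/-- IBP₀-algebras: involutive MTL-algebras with `(2x)² = 2(x²)`, where `2x = x ⊕ x`. -/
class IBP0Algebra (A : Type*) extends MTLAlgebra A where
  dl' : ∀ x : A, (oplus x x) ^ 2 = oplus (x ^ 2) (x ^ 2)
  neg_neg' : ∀ x : A, neg (neg x) = x

namespace IBP0Algebra

open MTLAlgebra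

variable {A : Type*} [IBP0Algebra A]

theorem sup_inf_neg_eq {a b : A} (ha : a ⊔ neg a = 1) (hb : b ⊔ neg b = 1) :
    (a ⊔ b) ⊔ neg (a ⊔ b) = 1 := by
  refine le_antisymm (le_one' _) ?_
  refine le_trans ?_ (sup_le_sup_left (neg_inf_neg_le a b) _)
  refine le_trans (le_inf ?_ ?_) (le_sup_inf' _ _ _)
  · rw [← ha]; exact sup_le_sup_right le_sup_left _
  · rw [← hb]; exact sup_le_sup_right le_sup_right _

theorem inf_sup_neg_eq {a b : A} (ha : a ⊔ neg a = 1) (hb : b ⊔ neg b = 1) :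
    (a ⊓ b) ⊔ neg (a ⊓ b) = 1 := by
  refine le_antisymm (le_one' _) ?_
  have h : neg a ⊔ neg b ≤ neg (a ⊓ b) :=
    sup_le (neg_anti inf_le_left) (neg_anti inf_le_right)
  rw [sup_comm]
  refine le_trans (le_inf ?_ ?_) (le_sup_inf' _ _ _)
  · rw [← ha, sup_comm]; exact sup_le_sup_right (le_sup_left.trans h) _
  · rw [← hb, sup_comm]; exact sup_le_sup_right (le_sup_right.trans h) _

theorem neg_sup_neg_eq {a : A} (ha : a ⊔ neg a = 1) : neg a ⊔ neg (neg a) = 1 := by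
  rw [neg_neg', sup_comm, ha]

theorem neg_zero_eq : neg (0 : A) = 1 := (le_iff_himp _ _).1 le_rfl

theorem neg_one_eq : neg (1 : A) = 0 := by rw [← neg_zero_eq, neg_neg']

/-- `ℬ(A)`, the set of `a` with `a ∨ ¬a = 1`. -/
def skeletonSet (A : Type*) [IBP0Algebra A] : Set A := {a | a ⊔ neg a = 1}

/-- `ℬ(A)` as a type. -/
abbrev Skeleton (A : Type*) [IBP0Algebra A] : Type _ := ↥(skeletonSet A)

instance (A : Type*) [IBP0Algebra A] : Lattice (Skeleton A) :=
  Subtype.lattice (fun {_ _} ha hb => sup_inf_neg_eq ha hb)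
    (fun {_ _} ha hb => inf_sup_neg_eq ha hb)

/-- The Boolean algebra structure of `ℬ(A)`: order, join, meet, complement and bounds are the
restrictions of those of `A`. -/
instance instBooleanAlgebraSkeleton (A : Type*) [IBP0Algebra A] : BooleanAlgebra (Skeleton A) where
  le_sup_inf x y z := le_sup_inf' (x : A) y z
  compl a := ⟨neg (a : A), neg_sup_neg_eq a.2⟩
  top := ⟨1, le_antisymm (le_one' _) le_sup_left⟩
  bot := ⟨0, by show (0 : A) ⊔ neg 0 = 1; rw [neg_zero_eq]; exact sup_eq_right.2 (le_one' _)⟩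
  le_top a := le_one' (a : A)
  bot_le a := zero_le' (a : A)
  inf_compl_le_bot a := by
    show (a : A) ⊓ neg (a : A) ≤ 0
    have h : (a : A) ⊓ neg (a : A) = ((a : A) ⊓ neg (a : A)) * ((a : A) ⊔ neg (a : A)) := by
      rw [show (a : A) ⊔ neg (a : A) = 1 from a.2, mul_one]
    rw [h, mul_sup_distrib]
    refine sup_le ((mul_mono_right inf_le_right _).trans (himp_mul_le _ _))
      ((mul_mono_right inf_le_left _).trans (mul_himp_le _ _))
  top_le_sup_compl a := (show (a : A) ⊔ neg (a : A) = 1 from a.2).ge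

/-- `ℋ(A)`, the set of `x` with `x > ¬x`. -/
def radicalSet (A : Type*) [IBP0Algebra A] : Set A := {x | neg x < x}

/-- `ℋ(A)` as a type. -/
abbrev RadicalPart (A : Type*) [IBP0Algebra A] : Type _ := ↥(radicalSet A)

theorem zero_ne_one' [Nontrivial A] : (0 : A) ≠ 1 := by
  intro h
  obtain ⟨x, y, hxy⟩ := exists_pair_ne A
  have : ∀ z : A, z = 0 := fun z => le_antisymm ((le_one' z).trans h.ge) (zero_le' z)
  exact hxy ((this x).trans (this y).symm)

theorem neg_ne_self [Nontrivial A] (x : A) : neg x ≠ x := by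
  intro h
  have h1 : oplus x x = 1 := (le_iff_himp _ _).1 h.le
  have h2 : x ^ 2 = 0 := by
    have := mul_neg_self x
    rwa [h, ← pow_two] at this
  have h3 := dl' x
  rw [h1, h2, one_pow] at h3
  have h4 : oplus (0 : A) 0 = 0 := by
    show neg (neg (0 : A)) = 0
    exact neg_neg' 0
  exact zero_ne_one' (h4.symm.trans h3.symm)

theorem mem_radicalSet [Nontrivial A] {x : A} : x ∈ radicalSet A ↔ neg x ≤ x :=
  ⟨fun h => le_of_lt h, fun h => lt_of_le_of_ne h (neg_ne_self x)⟩

theorem radicalSet_upward [Nontrivial A] {x y : A} (hx : x ∈ radicalSet A) (h : x ≤ y) :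
    y ∈ radicalSet A :=
  mem_radicalSet.2 ((neg_anti h).trans ((mem_radicalSet.1 hx).trans h))

theorem neg_le_of_mem [Nontrivial A] {x y : A} (hx : x ∈ radicalSet A) (hy : y ∈ radicalSet A) :
    neg y ≤ x := by
  rw [mem_radicalSet] at hx hy
  have hsq : ∀ z : A, neg z ≤ z → neg z * neg z ≤ 0 := fun z hz =>
    (mul_mono_right hz _).trans (mul_neg_self z).le
  have contra : ∀ p q : A, neg q * (p ⇨ q) ≤ neg p := fun p q => by
    show _ ≤ p ⇨ (0 : A)
    rw [← mul_le_iff', mul_assoc]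
    exact (mul_mono le_rfl (himp_mul_le p q)).trans (himp_mul_le q 0)
  have h : neg y * neg x ≤ 0 := by
    have e : neg y * neg x = neg y * neg x * ((x ⇨ y) ⊔ (y ⇨ x)) := by rw [prelinear', mul_one]
    rw [e, mul_sup_distrib]
    refine sup_le ?_ ?_
    · rw [mul_right_comm]
      exact (mul_mono_right (contra x y) _).trans (hsq x hx)
    · rw [mul_assoc]
      exact (mul_mono le_rfl (contra y x)).trans (hsq y hy)
  have h' := (mul_le_iff' _ _ _).1 h
  have h'' : neg (neg x) = x := neg_neg' x
  exact h'.trans h''.le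

theorem one_mem_radicalSet [Nontrivial A] : (1 : A) ∈ radicalSet A :=
  mem_radicalSet.2 (le_one' _)

theorem inf_mem_radicalSet [Nontrivial A] {x y : A} (hx : x ∈ radicalSet A)
    (hy : y ∈ radicalSet A) : x ⊓ y ∈ radicalSet A := by
  rw [mem_radicalSet]
  have h : x ⊓ y = neg (neg x ⊔ neg y) := by
    refine le_antisymm ?_ (le_inf ?_ ?_)
    · have := neg_inf_neg_le (neg x) (neg y)
      rwa [neg_neg', neg_neg'] at this
    · have := neg_anti (le_sup_left : neg x ≤ neg x ⊔ neg y)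
      rwa [neg_neg'] at this
    · have := neg_anti (le_sup_right : neg y ≤ neg x ⊔ neg y)
      rwa [neg_neg'] at this
  have h' : neg (x ⊓ y) = neg x ⊔ neg y := by rw [h, neg_neg']
  rw [h']
  exact sup_le (le_inf (le_of_lt hx) (neg_le_of_mem hy hx))
    (le_inf (neg_le_of_mem hx hy) (le_of_lt hy))

theorem mul_mem_radicalSet [Nontrivial A] {x y : A} (hx : x ∈ radicalSet A)
    (hy : y ∈ radicalSet A) : x * y ∈ radicalSet A := by
  have hz := inf_mem_radicalSet hx hy
  have h1 : oplus (x ⊓ y) (x ⊓ y) = 1 := (le_iff_himp _ _).1 (le_of_lt hz)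
  have h2 : oplus ((x ⊓ y) ^ 2) ((x ⊓ y) ^ 2) = 1 := by rw [← dl', h1, one_pow]
  have h3 : (x ⊓ y) ^ 2 ∈ radicalSet A := mem_radicalSet.2 ((le_iff_himp _ _).2 h2)
  refine radicalSet_upward h3 ?_
  rw [pow_two]
  exact mul_mono inf_le_left inf_le_right

/-- The prelinear semihoop structure of `ℋ(A)`: order, meet, product, residual and unit are the
restrictions of those of `A`. (If `A` has one element then `ℋ(A)` is empty.) -/
instance instPrelinearSemihoopRadicalPart (A : Type*) [IBP0Algebra A] [Nontrivial A] :
    PrelinearSemihoop (RadicalPart A) where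
  toSemilatticeInf := Subtype.semilatticeInf fun {_ _} hx hy => inf_mem_radicalSet hx hy
  mul x y := ⟨(x : A) * y, mul_mem_radicalSet x.2 y.2⟩
  one := ⟨1, one_mem_radicalSet⟩
  mul_assoc x y z := Subtype.ext (mul_assoc (x : A) y z)
  one_mul x := Subtype.ext (one_mul (x : A))
  mul_one x := Subtype.ext (mul_one (x : A))
  mul_comm x y := Subtype.ext (mul_comm (x : A) y)
  himp x y := ⟨(x : A) ⇨ y, radicalSet_upward y.2 ((mul_le_iff' _ _ _).1 (mul_le_left _ _))⟩
  le_one' x := MTLAlgebra.le_one' (x : A)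
  mul_mono' x y z h := mul_mono_right (show (x : A) ≤ y from h) (z : A)
  le_iff_himp' x y := (le_iff_himp (x : A) y).trans ⟨fun h => Subtype.ext h, fun h => congrArg Subtype.val h⟩
  mul_himp' x y z := Subtype.ext (mul_himp (x : A) y z)
  prelinear' x y z := prelinear_semihoop (x : A) y z

theorem boolPart_mem (a : A) : neg ((neg (a ^ 2)) ^ 2) ∈ skeletonSet A := by
  have e : neg ((neg (a ^ 2)) ^ 2) = (oplus a a) ^ 2 := by
    rw [dl']
    unfold oplus
    conv_rhs => rw [← neg_neg' (a ^ 2)]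
    unfold neg
    rw [← mul_himp, pow_two (a ^ 2 ⇨ (0 : A))]
    have h : (a ^ 2 ⇨ (0 : A)) ⇨ 0 = a ^ 2 := neg_neg' (a ^ 2)
    rw [h]
  have h1 : oplus a a ⊔ neg (a ^ 2) = 1 := by
    have := prelinear' (neg a) a
    unfold oplus
    have h2 : a ⇨ neg a = neg (a ^ 2) := by
      unfold neg
      rw [← mul_himp, pow_two]
    rwa [h2] at this
  have h2 := sup_sq_eq_one h1
  show _ ⊔ neg _ = 1
  rw [neg_neg', e]
  exact h2

/-- The Boolean element `b_a = ¬((¬(a²))²)`. -/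
def boolPart (a : A) : Skeleton A := ⟨neg ((neg (a ^ 2)) ^ 2), boolPart_mem a⟩

/-- The element `c_a = a ∨ ¬a` of `ℋ(A)`. -/
def radPart [Nontrivial A] (a : A) : RadicalPart A :=
  ⟨a ⊔ neg a, mem_radicalSet.2 ((neg_anti le_sup_left).trans le_sup_right)⟩

/-- The join `b ∨ c ∈ ℋ(A)`, taken in `A`, of `b ∈ ℬ(A)` and `c ∈ ℋ(A)`. -/
def joinRad [Nontrivial A] (b : Skeleton A) (c : RadicalPart A) : RadicalPart A :=
  ⟨(b : A) ⊔ c, radicalSet_upward c.2 le_sup_right⟩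

end IBP0Algebra

/-! ### The Stone space of a Boolean algebra -/

/-- `Max(B)`: the set of maximal (proper) filters of the Boolean algebra `B`. -/
def StoneMax (B : Type*) [BooleanAlgebra B] : Type _ := {F : Order.PFilter B // IsCoatom F}

namespace StoneMax

variable {B : Type*} [BooleanAlgebra B]

/-- The set of maximal filters containing `b`, which corresponds to `b` under Stone duality. -/
def basicClopen (b : B) : Set (StoneMax B) := {F | b ∈ F.1}

/-- The Stone topology. -/
instance : TopologicalSpace (StoneMax B) :=
  TopologicalSpace.generateFrom (Set.range (basicClopen (B := B)))

instance : MeasurableSpace (StoneMax B) := borel (StoneMax B)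

instance : BorelSpace (StoneMax B) := ⟨rfl⟩

/-- The characteristic function `b*` of the clopen set corresponding to `b`. -/
noncomputable def charFun (b : B) : StoneMax B → ℝ := (basicClopen b).indicator 1

end StoneMax

/-! ### The MV-algebra `Γ(ℝ × ℝ, (1,0))` and hyperstates -/

namespace LexReal

/-- The strong unit `(1,0)` of the lexicographic product `ℝ × ℝ`. -/
def unit : ℝ ×ₗ ℝ := toLex (1, 0)

/-- The embedding `r ↦ (r,0)` of the reals. -/
def ofReal (r : ℝ) : ℝ ×ₗ ℝ := toLex (r, 0)

/-- `x` is infinitesimal with respect to the unit. -/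
def IsInfinitesimal (x : ℝ ×ₗ ℝ) : Prop := ∀ n : ℕ, n • |x| < unit

end LexReal

/-- The domain `{x | (0,0) ≤ x ≤ (1,0)}` of `ℒ(ℝ) = Γ(ℝ × ℝ, (1,0))`, with the lexicographic
order on `ℝ × ℝ`. -/
abbrev LexUnitInterval : Type := ↥(Set.Icc (0 : ℝ ×ₗ ℝ) LexReal.unit)

open MTLAlgebra in
/-- Hyperstates. The sums in (s2) are taken in the lexicographic group `ℝ × ℝ`, and the real
interval `[0,1]` in (s3) is identified with `[0,1] × {0}`. -/
structure IsHyperstate {A : Type*} [IBP0Algebra A] (s : A → LexUnitInterval) : Prop where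
  map_one : (s 1 : ℝ ×ₗ ℝ) = LexReal.unit
  map_zero : (s 0 : ℝ ×ₗ ℝ) = 0
  map_oplus_add_map_mul : ∀ x y : A,
    (s (oplus x y) : ℝ ×ₗ ℝ) + (s (x * y) : ℝ ×ₗ ℝ) = (s x : ℝ ×ₗ ℝ) + (s y : ℝ ×ₗ ℝ)
  map_skeleton : ∀ x : A, x ⊔ neg x = 1 → ∃ r ∈ Set.Icc (0 : ℝ) 1, (s x : ℝ ×ₗ ℝ) = LexReal.ofReal r

theorem IsHyperstate.nontrivial {A : Type*} [IBP0Algebra A] {s : A → LexUnitInterval}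
    (hs : IsHyperstate s) : Nontrivial A := by
  refine ⟨0, 1, fun h => ?_⟩
  have h1 := hs.map_one
  rw [← h, hs.map_zero] at h1
  have h2 : (0 : ℝ) = 1 := congrArg (fun x : ℝ ×ₗ ℝ => (ofLex x).1) h1
  exact zero_ne_one h2

/-! Both coordinates of a hyperstate are real valuations: maps `v` with `v (x ⊕ y) + v (x * y) = v x
+ v y` and `v 0 = 0`. The Boolean element `b` attached to `a` marks where `a` lies above `¬a`:
multiplied by `b`, `a` agrees with `c = a ∨ ¬a`; multiplied by `¬b`, it agrees with `¬c`. Hence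
every valuation satisfies `v a = v b + v (¬b ∨ c) - v (b ∨ c)` (`valuation_eq`), and it remains to
identify each coordinate on the skeleton and on the radical.

The first coordinate is constantly `1` on the radical, by an Archimedean argument on powers
(`fstPart_of_mem_radical`), so it sends `a` to its value at `b`. On the skeleton it is finitely
additive of total mass `1`, hence comes from a regular Borel probability measure on the Stone space
(`exists_regular_measure`). The second coordinate vanishes on the skeleton, and on the radical it is
a semihoop state `w` (`isSemihoopState_sndPart`). With `ε = (0, 1)` the two coordinates assemble
into the formula. -/

/-! ### Topology of the Stone space: compact, Hausdorff, with a clopen base -/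

namespace StoneMax

variable {B : Type*} [BooleanAlgebra B]

theorem bot_notMem (F : StoneMax B) : ⊥ ∉ F.1 := fun h =>
  F.2.1 (top_le_iff.1 fun _ _ => Order.PFilter.mem_of_le bot_le h)

theorem mem_or_compl_mem (F : StoneMax B) (b : B) : b ∈ F.1 ∨ bᶜ ∈ F.1 := by
  by_contra! h
  -- The filter generated by `F` and `b`. It is strictly larger than `F`, hence improper, so some `f
  -- ∈ F` is disjoint from `b` and lies below `bᶜ`.
  let G : Order.PFilter B := Order.IsPFilter.toPFilter (F := {x | ∃ f ∈ F.1, f ⊓ b ≤ x}) <|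
    Order.IsPFilter.of_def ⟨⊤, ⊤, Order.PFilter.top_mem, le_top⟩
      (fun x ⟨f, hf, hx⟩ y ⟨g, hg, hy⟩ => ⟨x ⊓ y,
        ⟨f ⊓ g, Order.PFilter.inf_mem hf hg, le_inf
          ((inf_le_inf_right _ inf_le_left).trans hx)
          ((inf_le_inf_right _ inf_le_right).trans hy)⟩, inf_le_left, inf_le_right⟩)
      (fun hxy ⟨f, hf, hx⟩ => ⟨f, hf, hx.trans hxy⟩)
  have hFG : F.1 < G := by
    refine lt_of_le_not_ge (fun f hf => ⟨f, hf, inf_le_left⟩) fun hGF => h.1 (hGF ?_)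
    exact ⟨⊤, Order.PFilter.top_mem, inf_le_right⟩
  have hbot : (⊥ : B) ∈ G := by
    rw [F.2.2 G hFG]
    trivial
  obtain ⟨f, hf, hfb⟩ := hbot
  exact h.2 (Order.PFilter.mem_of_le (le_compl_iff_disjoint_right.2 (disjoint_iff_inf_le.2 hfb)) hf)

theorem compl_mem_iff (F : StoneMax B) (b : B) : bᶜ ∈ F.1 ↔ b ∉ F.1 := by
  refine ⟨fun h h' => F.bot_notMem ?_, (F.mem_or_compl_mem b).resolve_left⟩
  rw [← inf_compl_eq_bot (a := b)]
  exact Order.PFilter.inf_mem h' h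

theorem basicClopen_compl (b : B) : basicClopen bᶜ = (basicClopen b)ᶜ :=
  Set.ext fun F => F.compl_mem_iff b

theorem basicClopen_inf (a b : B) : basicClopen (a ⊓ b) = basicClopen a ∩ basicClopen b :=
  Set.ext fun _ => Order.PFilter.inf_mem_iff

theorem basicClopen_sup (a b : B) : basicClopen (a ⊔ b) = basicClopen a ∪ basicClopen b := by
  rw [← compl_compl (a ⊔ b), compl_sup, basicClopen_compl, basicClopen_inf, basicClopen_compl,
    basicClopen_compl, Set.compl_inter, compl_compl, compl_compl]

theorem basicClopen_top : basicClopen (⊤ : B) = Set.univ :=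
  Set.eq_univ_of_forall fun _ => Order.PFilter.top_mem

theorem basicClopen_bot : basicClopen (⊥ : B) = ∅ :=
  Set.eq_empty_of_forall_notMem bot_notMem

theorem basicClopen_finset_sup (t : Finset B) :
    basicClopen (t.sup id) = ⋃ b ∈ t, basicClopen b := by
  classical
  induction t using Finset.induction_on with
  | empty => simp [basicClopen_bot]
  | insert a t _ ih => simp [basicClopen_sup, ih]

theorem isOpen_basicClopen (b : B) : IsOpen (basicClopen b) :=
  TopologicalSpace.isOpen_generateFrom_of_mem ⟨b, rfl⟩

theorem isClopen_basicClopen (b : B) : IsClopen (basicClopen b) := by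
  refine ⟨⟨?_⟩, isOpen_basicClopen b⟩
  rw [← basicClopen_compl]
  exact isOpen_basicClopen _

/-- A proper ideal is avoided by some maximal filter. -/
theorem exists_forall_mem_ideal_notMem (I : Order.Ideal B) (hI : ⊤ ∉ I) :
    ∃ F : StoneMax B, ∀ x ∈ I, x ∉ F.1 := by
  obtain ⟨J, hJ, hIJ, hd⟩ := DistribLattice.prime_ideal_of_disjoint_filter_ideal
    (F := Order.PFilter.principal (⊤ : B)) (I := I) (by
      rw [Set.disjoint_left]
      intro x hx hxI
      exact hI (top_le_iff.1 (Order.PFilter.mem_principal.1 hx) ▸ hxI))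
  have hmem : ∀ x, x ∈ hJ.toPrimePair.F ↔ x ∉ J := fun _ => Iff.rfl
  refine ⟨⟨hJ.toPrimePair.F, ?_, ?_⟩, fun x hx => fun h => (hmem x).1 h (hIJ hx)⟩
  · intro h
    have : (⊥ : B) ∈ hJ.toPrimePair.F := by rw [h]; trivial
    exact (hmem _).1 this J.bot_mem
  -- The complement of a prime ideal is a maximal filter: a larger `G` contains some `x ∈ J`, but
  -- primality puts `xᶜ` outside `J`, so `G` contains both `x` and `xᶜ`.
  · intro G hG
    obtain ⟨x, hxG, hxF⟩ := Set.exists_of_ssubset (show (hJ.toPrimePair.F : Set B) ⊂ G from hG)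
    have hxJ : x ∈ J := by_contra fun h => hxF ((hmem x).2 h)
    have hc : xᶜ ∈ G := hG.le <| (hmem _).2 fun h => by
      have := hJ.top_notMem
      rw [← sup_compl_eq_top (x := x)] at this
      exact this (Order.Ideal.sup_mem hxJ h)
    refine top_le_iff.1 fun y _ => Order.PFilter.mem_of_le bot_le ?_
    rw [← inf_compl_eq_bot (a := x)]
    exact Order.PFilter.inf_mem hxG hc

/-- If `a ≰ b`, then `aᶜ ⊔ b` generates a proper ideal; a maximal filter avoiding it contains `a`
but not `b`. -/
theorem basicClopen_subset_iff {a b : B} : basicClopen a ⊆ basicClopen b ↔ a ≤ b := by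
  refine ⟨fun h => ?_, fun h F hF => Order.PFilter.mem_of_le h hF⟩
  by_contra hab
  obtain ⟨F, hF⟩ := exists_forall_mem_ideal_notMem (Order.Ideal.principal (aᶜ ⊔ b)) fun ht => hab <| by
    have ht := Order.Ideal.mem_principal.1 ht
    rw [← himp_eq_top_iff, himp_eq, sup_comm]
    exact top_le_iff.1 ht
  have ha : a ∈ F.1 := by
    have := hF aᶜ (Order.Ideal.mem_principal.2 le_sup_left)
    rwa [compl_mem_iff, not_not] at this
  exact hF b (Order.Ideal.mem_principal.2 le_sup_right) (h ha)

/-- By Alexander's subbase theorem only covers by basic clopen sets matter. The elements lying below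
finite joins from the cover form an ideal. Were it proper, a maximal filter avoiding it would be
uncovered; so `⊤` lies below a finite join, which is a finite subcover. -/
instance : CompactSpace (StoneMax B) := by
  classical
  refine compactSpace_generateFrom rfl fun P hP hcov => ?_
  let I : Order.Ideal B := Order.IsIdeal.toIdeal
    (I := {x | ∃ t : Finset B, (∀ b ∈ t, basicClopen b ∈ P) ∧ x ≤ t.sup id})
    ⟨fun x y hyx ⟨t, ht, hx⟩ => ⟨t, ht, le_trans hyx hx⟩, ⟨⊥, ∅, by simp, bot_le⟩,
      fun x ⟨t, ht, hx⟩ y ⟨u, hu, hy⟩ => ⟨x ⊔ y, ⟨t ∪ u, fun b hb =>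
        (Finset.mem_union.1 hb).elim (ht b) (hu b), by
          rw [Finset.sup_union]; exact sup_le_sup hx hy⟩, le_sup_left, le_sup_right⟩⟩
  have htop : ⊤ ∈ I := by
    by_contra hI
    obtain ⟨F, hF⟩ := exists_forall_mem_ideal_notMem I hI
    obtain ⟨_, hU, hFU⟩ := Set.mem_sUnion.1 (hcov.symm ▸ Set.mem_univ F)
    obtain ⟨b, rfl⟩ := hP hU
    exact hF b ⟨{b}, by simpa using hU, by simp⟩ hFU
  obtain ⟨t, ht, htop⟩ := htop
  refine ⟨basicClopen '' (t : Set B), ?_, t.finite_toSet.image _, ?_⟩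
  · rintro _ ⟨b, hb, rfl⟩
    exact ht b hb
  · rw [Set.sUnion_image]
    simp only [SetLike.mem_coe]
    rw [← basicClopen_finset_sup, top_le_iff.1 htop, basicClopen_top]

theorem exists_basicClopen_of_ne {F G : StoneMax B} (h : F ≠ G) :
    ∃ b, F ∈ basicClopen b ∧ G ∈ basicClopen bᶜ := by
  by_contra! hb
  refine h (Subtype.ext (le_antisymm (fun b hF => ?_) fun b hG => ?_))
  · have := hb b hF
    rwa [basicClopen_compl, Set.notMem_compl_iff] at this
  · by_contra hF
    have := hb bᶜ ((F.compl_mem_iff b).2 hF)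
    rw [compl_compl] at this
    exact this hG

instance : T2Space (StoneMax B) where
  t2 F G h := by
    obtain ⟨b, hF, hG⟩ := exists_basicClopen_of_ne h
    refine ⟨_, _, isOpen_basicClopen b, isOpen_basicClopen bᶜ, hF, hG, ?_⟩
    rw [basicClopen_compl]
    exact disjoint_compl_right

theorem exists_basicClopen_of_notMem_isCompact {K : Set (StoneMax B)} (hK : IsCompact K)
    {F : StoneMax B} (hF : F ∉ K) : ∃ b, F ∈ basicClopen b ∧ K ⊆ basicClopen bᶜ := by
  refine hK.induction_on (p := fun t => F ∈ K ∨ ∃ b, F ∈ basicClopen b ∧ t ⊆ basicClopen bᶜ)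
    (.inr ⟨⊤, Order.PFilter.top_mem, Set.empty_subset _⟩) ?_ ?_ ?_ |>.resolve_left hF
  · exact fun s t hst => Or.imp_right fun ⟨b, hb, ht⟩ => ⟨b, hb, hst.trans ht⟩
  · rintro s t (h | ⟨b, hb, hs⟩) (h' | ⟨c, hc, ht⟩)
    · exact .inl h
    · exact .inl h
    · exact .inl h'
    · refine .inr ⟨b ⊓ c, Order.PFilter.inf_mem hb hc, ?_⟩
      rw [compl_inf, basicClopen_sup]
      exact Set.union_subset_union hs ht
  · intro G hG
    obtain ⟨b, hb, hGb⟩ := exists_basicClopen_of_ne (F := F) (G := G) fun h => hF (h ▸ hG)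
    exact ⟨_, mem_nhdsWithin_of_mem_nhds ((isOpen_basicClopen _).mem_nhds hGb),
      .inr ⟨b, hb, subset_rfl⟩⟩

/-- Disjoint compact sets are separated by a basic clopen set. -/
theorem exists_basicClopen_separating {K L : Set (StoneMax B)} (hK : IsCompact K)
    (hL : IsCompact L) (h : Disjoint K L) : ∃ b, K ⊆ basicClopen b ∧ L ⊆ basicClopen bᶜ := by
  refine hK.induction_on (p := fun t => ∃ b, t ⊆ basicClopen b ∧ L ⊆ basicClopen bᶜ)
    ⟨⊥, Set.empty_subset _, by simp [basicClopen_top]⟩ ?_ ?_ ?_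
  · exact fun s t hst ⟨b, hb, ht⟩ => ⟨b, hst.trans hb, ht⟩
  · rintro s t ⟨b, hb, hs⟩ ⟨c, hc, ht⟩
    refine ⟨b ⊔ c, ?_, ?_⟩
    · rw [basicClopen_sup]
      exact Set.union_subset_union hb hc
    · rw [compl_sup, basicClopen_inf]
      exact Set.subset_inter hs ht
  · intro F hF
    obtain ⟨b, hb, hLb⟩ := exists_basicClopen_of_notMem_isCompact hL (Set.disjoint_left.1 h hF)
    exact ⟨_, mem_nhdsWithin_of_mem_nhds ((isOpen_basicClopen _).mem_nhds hb), b, subset_rfl, hLb⟩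

/-! ### From finitely additive functions to regular Borel measures -/

section Measure

open scoped NNReal

variable {m : B → ℝ≥0}

theorem monotone_of_additive (hadd : ∀ a b, Disjoint a b → m (a ⊔ b) = m a + m b) :
    Monotone m := fun a b hab => by
  rw [← sup_sdiff_cancel_right hab, hadd _ _ disjoint_sdiff_self_right]
  exact le_self_add

theorem subadditive_of_additive (hadd : ∀ a b, Disjoint a b → m (a ⊔ b) = m a + m b) (a b : B) :
    m (a ⊔ b) ≤ m a + m b := by
  rw [← sup_sdiff_self_right, hadd _ _ disjoint_sdiff_self_right]
  gcongr
  exact monotone_of_additive hadd sdiff_le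

/-- The infimum of `m` over the basic clopen sets containing `K`. -/
noncomputable def outerValue (m : B → ℝ≥0) (K : Set (StoneMax B)) : ℝ≥0 :=
  ⨅ b : {b : B // K ⊆ basicClopen b}, m b

instance (K : Set (StoneMax B)) : Nonempty {b : B // K ⊆ basicClopen b} :=
  ⟨⟨⊤, basicClopen_top (B := B) ▸ Set.subset_univ K⟩⟩

theorem outerValue_le {K : Set (StoneMax B)} {b : B} (h : K ⊆ basicClopen b) :
    outerValue m K ≤ m b :=
  ciInf_le (OrderBot.bddBelow _) (⟨b, h⟩ : {b : B // K ⊆ basicClopen b})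

theorem le_outerValue {K : Set (StoneMax B)} {r : ℝ≥0}
    (h : ∀ b, K ⊆ basicClopen b → r ≤ m b) : r ≤ outerValue m K :=
  le_ciInf fun b => h b b.2

theorem outerValue_basicClopen (hm : Monotone m) (b : B) :
    outerValue m (basicClopen b) = m b :=
  le_antisymm (outerValue_le subset_rfl)
    (le_outerValue fun _ hc => hm (basicClopen_subset_iff.1 hc))

/-- The content on the Stone space of `B` induced by a finitely additive function on `B`. -/
noncomputable def content (m : B → ℝ≥0)
    (hadd : ∀ a b, Disjoint a b → m (a ⊔ b) = m a + m b) : Content (StoneMax B) where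
  toFun K := outerValue m K
  mono' K L h := le_outerValue fun _ hb => outerValue_le (h.trans hb)
  sup_le' K L := by
    refine NNReal.le_iInf_add_iInf fun b c => ?_
    refine (outerValue_le ?_).trans (subadditive_of_additive hadd b c)
    rw [basicClopen_sup]
    exact Set.union_subset_union b.2 c.2
  sup_disjoint' K L hKL _ _ := by
    refine le_antisymm ?_ ?_
    · refine NNReal.le_iInf_add_iInf fun b c => ?_
      refine (outerValue_le ?_).trans (subadditive_of_additive hadd b c)
      rw [basicClopen_sup]
      exact Set.union_subset_union b.2 c.2
    -- Superadditivity: a separating `b` cuts any `d` covering `K ∪ L` into `d ⊓ b`, which covers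
    -- `K`, and `d ⊓ bᶜ`, which covers `L`.
    · obtain ⟨b, hK, hL⟩ := exists_basicClopen_separating K.isCompact L.isCompact hKL
      refine le_outerValue fun d hd => ?_
      rw [TopologicalSpace.Compacts.coe_sup, Set.union_subset_iff] at hd
      rw [← sup_inf_inf_compl (x := d) (y := b), hadd _ _
        (disjoint_compl_right.mono inf_le_right inf_le_right)]
      gcongr
      · exact outerValue_le (by rw [basicClopen_inf]; exact Set.subset_inter hd.1 hK)
      · exact outerValue_le (by rw [basicClopen_inf]; exact Set.subset_inter hd.2 hL)

/-- A finitely additive function on a Boolean algebra extends to a regular Borel measure on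
its Stone space. -/
theorem exists_regular_measure (hadd : ∀ a b, Disjoint a b → m (a ⊔ b) = m a + m b) :
    ∃ μ : Measure (StoneMax B), μ.Regular ∧ ∀ b, μ (basicClopen b) = m b := by
  refine ⟨(content m hadd).measure, inferInstance, fun b => ?_⟩
  have hb := isClopen_basicClopen b
  -- A basic clopen set is both open and compact, so its measure is exactly the value of the content
  -- there, with no approximation.
  rw [Content.measure_apply _ hb.isOpen.measurableSet, Content.outerMeasure_of_isOpen _ _ hb.isOpen,
    Content.innerContent_of_isCompact _ hb.isClosed.isCompact hb.isOpen]
  exact congrArg _ (outerValue_basicClopen (monotone_of_additive hadd) b)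

end Measure

end StoneMax

/-! ### Boolean elements and the decomposition of `a` by `boolPart a` -/

namespace IBP0Algebra

open MTLAlgebra

variable {A : Type*} [IBP0Algebra A]

theorem neg_sup_eq (x y : A) : neg (x ⊔ y) = neg x ⊓ neg y :=
  le_antisymm (le_inf (neg_anti le_sup_left) (neg_anti le_sup_right)) (neg_inf_neg_le x y)

theorem neg_mul_eq (x y : A) : neg (x * y) = oplus (neg x) (neg y) := by
  unfold oplus
  rw [neg_neg']
  exact mul_himp x y 0

/-- Inserting the factor `b ∨ ¬b = 1` and distributing splits an inequality into a part over `b` and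
a part over `¬b`; the next lemmas reuse this device. -/
theorem mul_self_of_mem_skeleton {b : A} (hb : b ∈ skeletonSet A) : b * b = b := by
  refine le_antisymm (mul_le_left b b) ?_
  have h : b * (b ⊔ neg b) = b := by rw [show b ⊔ neg b = 1 from hb, mul_one]
  conv_lhs => rw [← h, mul_sup_distrib, mul_neg_self]
  exact sup_le le_rfl (zero_le' _)

theorem mul_eq_inf_of_mem_skeleton {b : A} (hb : b ∈ skeletonSet A) (x : A) : b * x = b ⊓ x := by
  refine le_antisymm (le_inf (mul_le_left b x) (mul_le_right b x)) ?_
  have h : (b ⊓ x) * (b ⊔ neg b) = b ⊓ x := by rw [show b ⊔ neg b = 1 from hb, mul_one]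
  rw [← h, mul_sup_distrib]
  refine sup_le ?_ ?_
  · rw [mul_comm]
    exact mul_mono le_rfl inf_le_right
  · exact ((mul_mono_right inf_le_left _).trans (mul_neg_self b).le).trans (zero_le' _)

theorem oplus_eq_sup_of_mem_skeleton {b : A} (hb : b ∈ skeletonSet A) (x : A) :
    oplus b x = b ⊔ x := by
  refine le_antisymm ?_ (sup_le ?_ ?_)
  · have h : oplus b x * (b ⊔ neg b) = oplus b x := by
      rw [show b ⊔ neg b = 1 from hb, mul_one]
    rw [← h, mul_sup_distrib]
    exact sup_le_sup (mul_le_right _ _) (himp_mul_le _ _)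
  · rw [oplus, ← mul_le_iff', mul_neg_self]
    exact zero_le' _
  · exact (mul_le_iff' _ _ _).1 (mul_le_left _ _)

theorem coe_boolPart_eq_sq (a : A) : (boolPart a : A) = oplus a a ^ 2 := by
  change neg (neg (a ^ 2) ^ 2) = _
  rw [dl', pow_two (neg (a ^ 2)), neg_mul_eq, neg_neg']

theorem neg_boolPart_eq_sq (a : A) : neg (boolPart a : A) = neg (a ^ 2) ^ 2 := neg_neg' _

theorem neg_mem_skeleton {b : A} (hb : b ∈ skeletonSet A) : neg b ∈ skeletonSet A :=
  neg_sup_neg_eq hb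

theorem sq_le_self (x : A) : x ^ 2 ≤ x := by
  rw [pow_two]
  exact mul_le_left x x

/-- Over `boolPart a`, the element `a` dominates `¬a`: the former equals `(2a)²`, which is below `2a
= ¬a → a`. Idempotence keeps a spare copy of the Boolean factor. -/
theorem boolPart_mul_sup_neg (a : A) :
    (boolPart a : A) * (a ⊔ neg a) = boolPart a * a := by
  refine le_antisymm ?_ (mul_mono le_rfl le_sup_left)
  have h : (boolPart a : A) * neg a ≤ a := by
    rw [coe_boolPart_eq_sq]
    exact (mul_mono_right (sq_le_self _) _).trans (himp_mul_le _ _)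
  rw [mul_sup_distrib]
  refine sup_le le_rfl ?_
  conv_lhs => rw [← mul_self_of_mem_skeleton (boolPart a).2, mul_assoc]
  exact mul_mono le_rfl h

/-- Dually, `¬(boolPart a)` is `(¬(a²))²`, which is below `¬(a²) = a → ¬a`, so over it `a` lies
below `¬a`. -/
theorem neg_boolPart_mul_neg_sup_neg (a : A) :
    neg (boolPart a : A) * neg (a ⊔ neg a) = neg (boolPart a : A) * a := by
  rw [neg_sup_eq, neg_neg']
  refine le_antisymm (mul_mono le_rfl inf_le_right) ?_
  have h : neg (boolPart a : A) * a ≤ neg a := by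
    rw [neg_boolPart_eq_sq]
    refine (mul_mono_right (sq_le_self _) _).trans ?_
    rw [pow_two, neg_mul_eq, oplus, neg_neg']
    exact himp_mul_le _ _
  conv_lhs => rw [← mul_self_of_mem_skeleton (neg_mem_skeleton (boolPart a).2), mul_assoc]
  exact mul_mono le_rfl (le_inf h (mul_le_right _ _))

/-! ### Real valuations on the algebra -/

section Valuation

variable {v : A → ℝ} (hv : ∀ x y, v (oplus x y) + v (x * y) = v x + v y) (h0 : v 0 = 0)

include hv h0

theorem valuation_add_neg (x : A) : v x + v (neg x) = v 1 := by
  have h := hv x (neg x)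
  rwa [mul_neg_self, h0, add_zero, oplus, (le_iff_himp (neg x) _).1 le_rfl, eq_comm] at h

/-- The two pieces `b * x` and `neg b * x` have product `0` and `⊕`-sum `x`. -/
theorem valuation_split {b : A} (hb : b ∈ skeletonSet A) (x : A) :
    v x = v (b * x) + v (neg b * x) := by
  have h := hv (b * x) (neg b * x)
  have hmul : b * x * (neg b * x) = 0 :=
    le_antisymm ((mul_mono (mul_le_left _ _) (mul_le_left _ _)).trans (mul_neg_self b).le)
      (zero_le' _)
  have hsum : oplus (b * x) (neg b * x) = x := by
    refine le_antisymm ?_ ?_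
    · have e : oplus (b * x) (neg b * x) * (b ⊔ neg b) = oplus (b * x) (neg b * x) := by
        rw [show b ⊔ neg b = 1 from hb, mul_one]
      rw [← e, mul_sup_distrib]
      -- Involutivity lets the right summand of `⊕` be cancelled, just as residuation cancels the
      -- left one.
      have hc : oplus (b * x) (neg b * x) * neg (neg b * x) ≤ b * x := by
        refine le_trans ?_ (neg_neg' (b * x)).le
        change _ ≤ neg (b * x) ⇨ (0 : A)
        rw [← mul_le_iff', mul_right_comm]
        exact (mul_mono_right (himp_mul_le _ _) _).trans (mul_neg_self (neg b * x)).le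
      refine sup_le (le_trans (mul_mono le_rfl ?_) (hc.trans (mul_le_right _ _)))
        (le_trans (mul_mono le_rfl ?_) ((himp_mul_le _ _).trans (mul_le_right _ _)))
      · have := neg_anti (mul_le_left (neg b) x)
        rwa [neg_neg'] at this
      · exact neg_anti (mul_le_left b x)
    · have e : x * (b ⊔ neg b) = x := by rw [show b ⊔ neg b = 1 from hb, mul_one]
      conv_lhs => rw [← e, mul_sup_distrib, mul_comm x b, mul_comm x (neg b)]
      refine sup_le ?_ ((mul_le_iff' _ _ _).1 (mul_le_left _ _))
      rw [oplus, ← mul_le_iff', mul_neg_self]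
      exact zero_le' _
  rw [hmul, hsum, h0, add_zero] at h
  exact h

theorem valuation_eq [Nontrivial A] (a : A) :
    v a = v (boolPart a : A) + (v (joinRad (boolPart a)ᶜ (radPart a) : A) -
      v (joinRad (boolPart a) (radPart a) : A)) := by
  have hb := (boolPart a).2
  have hnb := neg_mem_skeleton hb
  set b : A := (boolPart a : A) with hbdef
  set c : A := a ⊔ neg a with hc
  change v a = v b + (v (neg b ⊔ c) - v (b ⊔ c))
  -- `e3`, `e4`, `e5` and complementation give `v a = v (b * c) + v (neg b) - v (neg b * c)`; `e1`
  -- and `e2` turn the right-hand side into the same expression.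
  have e1 := hv b c
  have e2 := hv (neg b) c
  have e3 := hv (neg b) (neg c)
  have e4 := valuation_split hv h0 hb a
  have e5 := valuation_split hv h0 hb c
  have e6 := valuation_add_neg hv h0 b
  have e7 := valuation_add_neg hv h0 c
  have e8 := valuation_add_neg hv h0 (b * c)
  rw [oplus_eq_sup_of_mem_skeleton hb] at e1
  rw [oplus_eq_sup_of_mem_skeleton hnb] at e2
  rw [← neg_mul_eq, neg_boolPart_mul_neg_sup_neg] at e3
  rw [← boolPart_mul_sup_neg] at e4
  linarith

theorem valuation_sub_of_le {x y : A} (h : x ≤ y) : v y - v x = v (neg x * y) := by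
  have h1 := hv (neg x) y
  rw [oplus, neg_neg', (le_iff_himp _ _).1 h] at h1
  linarith [valuation_add_neg hv h0 x]

omit h0 in
-- Any two radical elements satisfy `¬x ≤ y`, that is, `x ⊕ y = 1`.
theorem valuation_mul_of_mem_radical [Nontrivial A] {x y : A} (hx : x ∈ radicalSet A)
    (hy : y ∈ radicalSet A) : v (x * y) = v x + v y - v 1 := by
  have h := hv x y
  rw [oplus, (le_iff_himp _ _).1 (neg_le_of_mem hy hx)] at h
  linarith

omit h0 in
theorem valuation_pow_of_mem_radical [Nontrivial A] {x : A} (hx : x ∈ radicalSet A) (n : ℕ) :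
    v (x ^ n) = v 1 - n * (v 1 - v x) ∧ x ^ n ∈ radicalSet A := by
  induction n with
  | zero => simpa using one_mem_radicalSet
  | succ n ih =>
    rw [pow_succ]
    refine ⟨?_, mul_mem_radicalSet ih.2 hx⟩
    rw [valuation_mul_of_mem_radical hv ih.2 hx, ih.1]
    push_cast
    ring

end Valuation

end IBP0Algebra

/-! ### The two coordinates of a hyperstate -/

namespace IsHyperstate

open MTLAlgebra IBP0Algebra

variable {A : Type*}

/-- The standard part of a map into `ℒ(ℝ)`. -/
def fstPart (s : A → LexUnitInterval) (x : A) : ℝ := (ofLex (s x : ℝ ×ₗ ℝ)).1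

/-- The infinitesimal part of a map into `ℒ(ℝ)`. -/
def sndPart (s : A → LexUnitInterval) (x : A) : ℝ := (ofLex (s x : ℝ ×ₗ ℝ)).2

theorem nonneg_lex (s : A → LexUnitInterval) (x : A) :
    0 < fstPart s x ∨ 0 = fstPart s x ∧ 0 ≤ sndPart s x :=
  Prod.Lex.le_iff.1 (s x).2.1

theorem lex_le_unit (s : A → LexUnitInterval) (x : A) :
    fstPart s x < 1 ∨ fstPart s x = 1 ∧ sndPart s x ≤ 0 :=
  Prod.Lex.le_iff.1 (s x).2.2

theorem fstPart_nonneg (s : A → LexUnitInterval) (x : A) : 0 ≤ fstPart s x := by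
  rcases nonneg_lex s x with h | h
  exacts [h.le, h.1.le]

variable [IBP0Algebra A] {s : A → LexUnitInterval} (hs : IsHyperstate s)

include hs

theorem fstPart_add (x y : A) :
    fstPart s (oplus x y) + fstPart s (x * y) = fstPart s x + fstPart s y :=
  congrArg (fun z : ℝ ×ₗ ℝ => (ofLex z).1) (hs.map_oplus_add_map_mul x y)

theorem sndPart_add (x y : A) :
    sndPart s (oplus x y) + sndPart s (x * y) = sndPart s x + sndPart s y :=
  congrArg (fun z : ℝ ×ₗ ℝ => (ofLex z).2) (hs.map_oplus_add_map_mul x y)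

theorem fstPart_zero : fstPart s 0 = 0 := congrArg (fun z : ℝ ×ₗ ℝ => (ofLex z).1) hs.map_zero

theorem sndPart_zero : sndPart s 0 = 0 := congrArg (fun z : ℝ ×ₗ ℝ => (ofLex z).2) hs.map_zero

theorem fstPart_one : fstPart s 1 = 1 := congrArg (fun z : ℝ ×ₗ ℝ => (ofLex z).1) hs.map_one

theorem sndPart_one : sndPart s 1 = 0 := congrArg (fun z : ℝ ×ₗ ℝ => (ofLex z).2) hs.map_one

theorem sndPart_of_mem_skeleton {b : A} (hb : b ∈ skeletonSet A) : sndPart s b = 0 := by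
  obtain ⟨r, -, hr⟩ := hs.map_skeleton b hb
  exact congrArg (fun z : ℝ ×ₗ ℝ => (ofLex z).2) hr

theorem fstPart_of_mem_radical {x : A} (hx : x ∈ radicalSet A) : fstPart s x = 1 := by
  have := hs.nontrivial
  rcases lex_le_unit s x with h | h
  -- This `n` makes `n * (1 - fstPart s x) > 1`, so the first coordinate of `s (x ^ n)` would be
  -- negative.
  · obtain ⟨n, hn⟩ := exists_nat_gt (1 / (1 - fstPart s x))
    rw [div_lt_iff₀ (by linarith)] at hn
    have h1 := (valuation_pow_of_mem_radical hs.fstPart_add hx n).1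
    rw [hs.fstPart_one] at h1
    linarith [fstPart_nonneg s (x ^ n)]
  · exact h.1

/-- On the radical the first coordinate is `1`, so `s x ≤ (1, 0)` forces a nonpositive second
coordinate. For `x ≤ y` the increment is the value at `neg x * y`, whose first coordinate is `0`, so
lexicographic positivity makes its second coordinate nonnegative. -/
theorem isSemihoopState_sndPart :
    haveI : Nontrivial A := hs.nontrivial
    IsSemihoopState fun x : RadicalPart A => sndPart s x := by
  have := hs.nontrivial
  refine ⟨fun x => ?_, hs.sndPart_one, fun x y => ?_, fun x y hxy => ?_⟩
  · rcases lex_le_unit s x with h | h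
    · exact absurd (hs.fstPart_of_mem_radical x.2) h.ne
    · exact h.2
  · have h := valuation_mul_of_mem_radical hs.sndPart_add x.2 y.2
    rwa [hs.sndPart_one, sub_zero] at h
  · have h1 := valuation_sub_of_le hs.fstPart_add hs.fstPart_zero (show (x : A) ≤ y from hxy)
    have h2 := valuation_sub_of_le hs.sndPart_add hs.sndPart_zero (show (x : A) ≤ y from hxy)
    rw [hs.fstPart_of_mem_radical x.2, hs.fstPart_of_mem_radical y.2, sub_self] at h1
    rcases nonneg_lex s (neg (x : A) * y) with h | h
    · exact absurd h1 h.ne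
    · exact sub_nonneg.1 (h2 ▸ h.2)

theorem fstPart_sup_of_disjoint {a b : Skeleton A} (h : Disjoint a b) :
    fstPart s (a ⊔ b : Skeleton A) = fstPart s a + fstPart s b := by
  have e := hs.fstPart_add a b
  have hinf : (a : A) ⊓ b = 0 := congrArg Subtype.val h.eq_bot
  rwa [oplus_eq_sup_of_mem_skeleton a.2, mul_eq_inf_of_mem_skeleton a.2, hinf, hs.fstPart_zero,
    add_zero] at e

end IsHyperstate

theorem mainTheorem5 {A : Type*} [IBP0Algebra A] (s : A → LexUnitInterval)
    (hs : IsHyperstate s) :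
    haveI : Nontrivial A := hs.nontrivial
    ∃ (μ : Measure (StoneMax (IBP0Algebra.Skeleton A))) (w : IBP0Algebra.RadicalPart A → ℝ)
      (ε : ℝ ×ₗ ℝ),
      IsProbabilityMeasure μ ∧ μ.Regular ∧ IsSemihoopState w ∧
      0 < ε ∧ LexReal.IsInfinitesimal ε ∧
      ∀ a : A,
        (s a : ℝ ×ₗ ℝ) =
          LexReal.ofReal (∫ F, StoneMax.charFun (IBP0Algebra.boolPart a) F ∂μ) +
            (w (IBP0Algebra.joinRad (IBP0Algebra.boolPart a)ᶜ (IBP0Algebra.radPart a)) -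
              w (IBP0Algebra.joinRad (IBP0Algebra.boolPart a) (IBP0Algebra.radPart a))) • ε := by
  have := hs.nontrivial
  obtain ⟨μ, hreg, hμ⟩ := StoneMax.exists_regular_measure
    (m := fun b : IBP0Algebra.Skeleton A =>
      (⟨IsHyperstate.fstPart s b, IsHyperstate.fstPart_nonneg s b⟩ : NNReal))
    fun a b h => NNReal.eq (hs.fstPart_sup_of_disjoint h)
  refine ⟨μ, _, toLex (0, 1), ⟨?_⟩, hreg, hs.isSemihoopState_sndPart, ?_, fun n => ?_,
    fun a => ?_⟩
  · rw [← StoneMax.basicClopen_top, hμ]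
    exact ENNReal.coe_eq_one.2 (NNReal.eq hs.fstPart_one)
  · exact Prod.Lex.lt_iff.2 (.inr ⟨rfl, zero_lt_one⟩)
  · have hpos : (0 : ℝ ×ₗ ℝ) < toLex (0, 1) := Prod.Lex.lt_iff.2 (.inr ⟨rfl, zero_lt_one⟩)
    rw [abs_of_pos hpos]
    exact Prod.Lex.lt_iff.2 (.inl (by simp [LexReal.unit]))
  · have hint : ∫ F, StoneMax.charFun (IBP0Algebra.boolPart a) F ∂μ =
        IsHyperstate.fstPart s (IBP0Algebra.boolPart a : A) := by
      unfold StoneMax.charFun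
      rw [integral_indicator_one (StoneMax.isOpen_basicClopen _).measurableSet, Measure.real, hμ]
      rfl
    rw [hint]
    -- In the first coordinate both joins lie in the radical and cancel; in the second, the skeleton
    -- term is zero.
    have h1 := IBP0Algebra.valuation_eq hs.fstPart_add hs.fstPart_zero a
    rw [hs.fstPart_of_mem_radical (Subtype.prop _), hs.fstPart_of_mem_radical (Subtype.prop _),
      sub_self, add_zero] at h1
    have h2 := IBP0Algebra.valuation_eq hs.sndPart_add hs.sndPart_zero a
    rw [hs.sndPart_of_mem_skeleton (Subtype.prop _)] at h2
    refine ofLex.injective (Prod.ext ?_ ?_)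
    · refine h1.trans ?_
      simp [LexReal.ofReal]
    · refine h2.trans ?_
      simp [LexReal.ofReal]
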